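/- Let $X=U\Sigma V^*$ and $X_l=U_l\Sigma_lV_l^*$ be two fixed real $n\times n$ matrices of rank $r$, with reduced singular value decompositions as written. For a matrix $W$ with orthonormal columns let $\mathcal P_W$ denote the orthogonal projection of $\mathbb R^n$ onto the column space of $W$; thus $\mathcal P_U,\mathcal P_V$ are the projections onto the column space and the row space of $X$, and likewise for $X_l$. Assume that both matrices are $\mu$-incoherent with $\mu>0$, that is, for $1\le i,j\le n$, $$\|\mathcal P_{U_l}(e_i)\|\le\sqrt{\frac{\mu r}{n}},\quad \|\mathcal P_{V_l}(e_j)\|\le\sqrt{\frac{\mu r}{n}},\quad \|\mathcal P_{U}(e_i)\|\le\sqrt{\frac{\mu r}{n}},\quad \|\mathcal P_{V}(e_j)\|\le\sqrt{\frac{\mu r}{n}},$$ where $e_1,\dots,e_n$ is the canonical basis of $\mathbb R^n$ and $\|\cdot\|$ is the Euclidean norm. Equip $\mathbb R^{n\times n}$ with the Frobenius inner product. On matrices, let $\mathcal P_U$ and $\mathcal P_{U_l}$ act column by column, $\mathcal P_U(Z)=UU^*Z$ and $\mathcal P_{U_l}(Z)=U_lU_l^*Z$, and let $\mathcal P_{T_l}$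 be the orthogonal projection onto the tangent space $$T_l=\{U_lZ_1^*+Z_2V_l^*:\ Z_1,Z_2\in\mathbb R^{n\times r}\}.$$ Let $\Omega=((i_k,j_k))_{k=1}^m$, $m\ge1$, be indices sampled independently from the uniform distribution on $\{1,\dots,n\}\times\{1,\dots,n\}$ (with replacement), and let $\mathcal P_\Omega$ map a matrix to its entrywise product with $\sum_{k=1}^m e_{i_k}e_{j_k}^*$. Then, for every $\beta>1$, if $m\ge 15\beta\mu nr\log(n)$, the inequality $$\left\|\frac{n^2}{m}\mathcal P_{T_l}\mathcal P_\Omega(\mathcal P_U-\mathcal P_{U_l})-\mathcal P_{T_l}(\mathcal P_U-\mathcal P_{U_l})\right\|\le\sqrt{\frac{48\beta\mu nr\log(n)}{m}}$$ holds with probability at least $1-2n^{2-2\beta}$, where the norm on the left is the spectral norm of a linear operator on $\mathbb R^{n\times n}$ with the Frobenius norm. -/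

import Mathlib

open MeasureTheory ProbabilityTheory

noncomputable section

namespace MatrixCompletion

/-- `X = U diag(σ) Vᵀ` is a reduced singular value decomposition with `r` (positive) singular
values; the columns of `U` and of `V` are orthonormal. -/
structure IsReducedSVD {n r : ℕ} (X : Matrix (Fin n) (Fin n) ℝ)
    (U : Matrix (Fin n) (Fin r) ℝ) (σ : Fin r → ℝ) (V : Matrix (Fin n) (Fin r) ℝ) : Prop where
  left_orthonormal : U.transpose * U = 1
  right_orthonormal : V.transpose * V = 1
  pos : ∀ k, 0 < σ k
  eq : X = U * Matrix.diagonal σ * V.transpose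

/-- The column space of a matrix, inside Euclidean space. -/
def colSpace {n k : ℕ} (A : Matrix (Fin n) (Fin k) ℝ) : Submodule ℝ (EuclideanSpace ℝ (Fin n)) :=
  LinearMap.range (Matrix.toEuclideanLin A)

/-- The orthogonal projection `P_U` of `ℝⁿ` onto the column space of `U`.
If `X = U Σ Vᵀ` is a reduced SVD, then `P_U` and `P_V` are the orthogonal projections onto the
column space and the row space of `X` (see `IsReducedSVD.colSpace_eq` and
`IsReducedSVD.rowSpace_eq`). -/
def vecProj {n k : ℕ} (U : Matrix (Fin n) (Fin k) ℝ) :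
    EuclideanSpace ℝ (Fin n) →L[ℝ] EuclideanSpace ℝ (Fin n) :=
  (colSpace U).starProjection

/-- `‖P_U e_i‖ ≤ √(μ r / n)` and `‖P_V e_j‖ ≤ √(μ r / n)` for all `i`, `j`: the matrix with singular
vectors `U`, `V` is `μ`-incoherent. -/
def IsIncoherent {n r : ℕ} (μ : ℝ) (U V : Matrix (Fin n) (Fin r) ℝ) : Prop :=
  (∀ i, ‖vecProj U (EuclideanSpace.single i 1)‖ ≤ √(μ * r / n)) ∧
    (∀ j, ‖vecProj V (EuclideanSpace.single j 1)‖ ≤ √(μ * r / n))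

/-- The space of real `n × n` matrices with the Frobenius inner product and norm. -/
abbrev FrobMat (n : ℕ) : Type := EuclideanSpace ℝ (Fin n × Fin n)

/-- The entrywise identification of `FrobMat n` with the `n × n` matrices. -/
def frobEquiv (n : ℕ) : FrobMat n ≃ₗ[ℝ] Matrix (Fin n) (Fin n) ℝ where
  toFun Z := Matrix.of fun i j => Z (i, j)
  invFun A := WithLp.toLp 2 fun p => A p.1 p.2
  map_add' _ _ := rfl
  map_smul' _ _ := rfl
  left_inv _ := rfl
  right_inv _ := rfl

/-- A linear map of matrices as an operator for the Frobenius norm. Its norm as a continuous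
linear map is the spectral norm of the operator. -/
def frobOp {n : ℕ} (f : Matrix (Fin n) (Fin n) ℝ →ₗ[ℝ] Matrix (Fin n) (Fin n) ℝ) :
    FrobMat n →L[ℝ] FrobMat n :=
  LinearMap.toContinuousLinearMap
    ((frobEquiv n).symm.toLinearMap ∘ₗ f ∘ₗ (frobEquiv n).toLinearMap)

/-- The operator `P_U` on matrices, which projects every column of a matrix onto the column
space of `U` (so that `P_U Z = U Uᵀ Z` if `U` has orthonormal columns). -/
def colProjOp {n k : ℕ} (U : Matrix (Fin n) (Fin k) ℝ) : FrobMat n →L[ℝ] FrobMat n :=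
  frobOp
    { toFun := fun Z => Matrix.of fun i j => vecProj U (WithLp.toLp 2 (fun i' => Z i' j)) i
      map_add' := fun A B => by
        ext i j
        have h : (WithLp.toLp 2 (fun i' => (A + B) i' j) : EuclideanSpace ℝ (Fin n)) =
          WithLp.toLp 2 (fun i' => A i' j) + WithLp.toLp 2 (fun i' => B i' j) := rfl
        simp only [Matrix.of_apply, Matrix.add_apply] at h ⊢
        rw [h, map_add]
        rfl
      map_smul' := fun c A => by
        ext i j
        have h : (WithLp.toLp 2 (fun i' => (c • A) i' j) : EuclideanSpace ℝ (Fin n)) =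
          c • WithLp.toLp 2 (fun i' => A i' j) := rfl
        simp only [Matrix.of_apply, Matrix.smul_apply, RingHom.id_apply] at h ⊢
        rw [h, map_smul]
        rfl }

/-- The tangent space `{U Z₁ᵀ + Z₂ Vᵀ : Z₁, Z₂ ∈ ℝ^{n × r}}` of the manifold of rank `r` matrices at
a matrix with singular vectors `U`, `V`. -/
def tangentSpace {n r : ℕ} (U V : Matrix (Fin n) (Fin r) ℝ) : Submodule ℝ (FrobMat n) where
  carrier := {W | ∃ Z₁ Z₂ : Matrix (Fin n) (Fin r) ℝ,
    frobEquiv n W = U * Z₁.transpose + Z₂ * V.transpose}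
  zero_mem' := ⟨0, 0, by simp⟩
  add_mem' := by
    rintro W W' ⟨A, B, h⟩ ⟨A', B', h'⟩
    refine ⟨A + A', B + B', ?_⟩
    rw [map_add, h, h', Matrix.transpose_add, Matrix.mul_add, Matrix.add_mul]
    abel
  smul_mem' := by
    rintro c W ⟨A, B, h⟩
    refine ⟨c • A, c • B, ?_⟩
    rw [map_smul, h, Matrix.transpose_smul, Matrix.mul_smul, Matrix.smul_mul, smul_add]

/-- The operator `P_T` on matrices: the orthogonal projection, for the Frobenius inner product,
onto the tangent space at a matrix with singular vectors `U`, `V`. -/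
def tangentProj {n r : ℕ} (U V : Matrix (Fin n) (Fin r) ℝ) : FrobMat n →L[ℝ] FrobMat n :=
  (tangentSpace U V).starProjection

/-- The sampling operator `P_Ω` of the list of indices `Ω = (ω 1, …, ω m)`, repetitions counted:
the entrywise product with the matrix `∑ k, e_{i_k} e_{j_k}ᵀ`, where `ω k = (i_k, j_k)`. -/
def sampling {n m : ℕ} (ω : Fin m → Fin n × Fin n) : FrobMat n →L[ℝ] FrobMat n :=
  frobOp
    { toFun := fun Z => Matrix.hadamard Z (∑ k, Matrix.single (ω k).1 (ω k).2 (1 : ℝ))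
      map_add' := fun A B => Matrix.add_hadamard _ A B
      map_smul' := fun c A => Matrix.smul_hadamard A _ c }

/-- `ω 1, …, ω m` are independent random indices, each uniformly distributed on
`{1, …, n} × {1, …, n}`. -/
structure IsUniformSample {S : Type*} [MeasurableSpace S] (P : Measure S) {n m : ℕ}
    (ω : Fin m → S → Fin n × Fin n) : Prop where
  measurable : ∀ k, Measurable (ω k)
  indep : iIndepFun ω P
  uniform : ∀ k, P.map (ω k) = uniformOn Set.univ

theorem IsReducedSVD.transpose {n r : ℕ} {X : Matrix (Fin n) (Fin n) ℝ}
    {U V : Matrix (Fin n) (Fin r) ℝ} {σ : Fin r → ℝ} (h : IsReducedSVD X U σ V) :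
    IsReducedSVD X.transpose V σ U :=
  ⟨h.right_orthonormal, h.left_orthonormal, h.pos, by
    rw [h.eq, Matrix.transpose_mul, Matrix.transpose_mul, Matrix.transpose_transpose,
      Matrix.diagonal_transpose, Matrix.mul_assoc]⟩

theorem IsReducedSVD.colSpace_eq {n r : ℕ} {X : Matrix (Fin n) (Fin n) ℝ}
    {U V : Matrix (Fin n) (Fin r) ℝ} {σ : Fin r → ℝ} (h : IsReducedSVD X U σ V) :
    colSpace X = colSpace U := by
  have hU : U = X * (V * Matrix.diagonal (fun k => (σ k)⁻¹)) := by
    have hd : Matrix.diagonal σ * Matrix.diagonal (fun k => (σ k)⁻¹) = 1 := by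
      rw [Matrix.diagonal_mul_diagonal, ← Matrix.diagonal_one]
      congr 1
      funext k
      exact mul_inv_cancel₀ (h.pos k).ne'
    rw [h.eq, Matrix.mul_assoc (U * Matrix.diagonal σ), ← Matrix.mul_assoc V.transpose,
      h.right_orthonormal, Matrix.one_mul, Matrix.mul_assoc, hd, Matrix.mul_one]
  apply le_antisymm
  · rintro _ ⟨x, rfl⟩
    refine ⟨WithLp.toLp 2 ((Matrix.diagonal σ * V.transpose).mulVec x.ofLp), ?_⟩
    rw [Matrix.toLpLin_apply, Matrix.toLpLin_apply, h.eq, Matrix.mulVec_mulVec,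
      Matrix.mul_assoc]
  · rintro _ ⟨x, rfl⟩
    refine ⟨WithLp.toLp 2 ((V * Matrix.diagonal (fun k => (σ k)⁻¹)).mulVec x.ofLp), ?_⟩
    rw [Matrix.toLpLin_apply, Matrix.toLpLin_apply, Matrix.mulVec_mulVec, ← hU]

theorem IsReducedSVD.rowSpace_eq {n r : ℕ} {X : Matrix (Fin n) (Fin n) ℝ}
    {U V : Matrix (Fin n) (Fin r) ℝ} {σ : Fin r → ℝ} (h : IsReducedSVD X U σ V) :
    colSpace X.transpose = colSpace V :=
  h.transpose.colSpace_eq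

theorem IsReducedSVD.rank_eq {n r : ℕ} {X : Matrix (Fin n) (Fin n) ℝ}
    {U V : Matrix (Fin n) (Fin r) ℝ} {σ : Fin r → ℝ} (h : IsReducedSVD X U σ V) :
    X.rank = r := by
  apply le_antisymm
  · rw [h.eq, Matrix.mul_assoc]
    exact (Matrix.rank_mul_le_left _ _).trans ((Matrix.rank_le_width U))
  · have hd : U.transpose * X * V = Matrix.diagonal σ := by
      rw [h.eq]
      calc U.transpose * (U * Matrix.diagonal σ * V.transpose) * V
          = (U.transpose * U) * Matrix.diagonal σ * (V.transpose * V) := by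
            simp only [Matrix.mul_assoc]
        _ = Matrix.diagonal σ := by
            rw [h.left_orthonormal, h.right_orthonormal, Matrix.one_mul, Matrix.mul_one]
    have hr : (Matrix.diagonal σ).rank = r := by
      have hu : IsUnit (Matrix.diagonal σ) := by
        rw [Matrix.isUnit_iff_isUnit_det, Matrix.det_diagonal, isUnit_iff_ne_zero]
        exact Finset.prod_ne_zero_iff.mpr fun k _ => (h.pos k).ne'
      rw [Matrix.rank_of_isUnit _ hu, Fintype.card_fin]
    calc r = (U.transpose * X * V).rank := by rw [hd, hr]
      _ ≤ (U.transpose * X).rank := Matrix.rank_mul_le_left _ _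
      _ ≤ X.rank := Matrix.rank_mul_le_right _ _

end MatrixCompletion

end

/-! Write A for the tangent projection, B for the difference of the two column projections, and N =
n². Since B is self-adjoint, the operator to be bounded is the average over k of the centred
rank-one operators N·(A e_p)(B e_p)* − AB, with p = ω k (`comp_sampling_comp`). These are i.i.d.
with mean zero, so a noncommutative Bernstein inequality applies.

Incoherence controls both the range and the variance. With q = μr/n one has ‖A e_p‖² ≤ 2q
(`norm_sq_tangentProj_single_le`) and ‖B e_p‖² ≤ 4q, while ‖A‖ ≤ 1 and ‖B‖ ≤ 1
(`norm_sub_le_one_of_isStarProjection`).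

The Bernstein bound follows Ahlswede and Winter: dilate to symmetric matrices, apply Markov's
inequality to the trace of the exponential, and peel off the samples one at a time with
Golden–Thompson (`trace_exp_add_le`, `sum_trace_exp_sum_le`). Uniform samples make all N^m outcomes
equally likely, so the argument counts bad outcomes and returns to probability only at the end. -/

namespace MatrixCompletion

/-! ### Golden–Thompson via trace inequalities for powers and the Lie product formula. -/

section GoldenThompson

open Matrix Filter Topology NormedSpace
open scoped Matrix.Norms.L2Operator

variable {J : Type*} [Fintype J] [DecidableEq J]

-- Expand tr (A − Bᵀ)(A − Bᵀ)ᵀ ≥ 0.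
omit [DecidableEq J] in
theorem two_mul_trace_mul_le (A B : Matrix J J ℝ) :
    2 * (A * B).trace ≤ (A * Aᵀ).trace + (Bᵀ * B).trace := by
  have h := (posSemidef_self_mul_conjTranspose (A - Bᵀ)).trace_nonneg
  simp only [conjTranspose_eq_transpose_of_trivial, transpose_sub, transpose_transpose,
    Matrix.sub_mul, Matrix.mul_sub, trace_sub] at h
  have h1 : (Bᵀ * Aᵀ).trace = (A * B).trace := by
    rw [← transpose_mul, trace_transpose]
  linarith

theorem trace_mul_pow_comm (A B : Matrix J J ℝ) (k : ℕ) :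
    ((A * B) ^ k).trace = ((B * A) ^ k).trace := by
  rcases k with _ | k
  · simp
  · have h : (A * B) ^ (k + 1) = A * ((B * A) ^ k * B) := by
      induction k with
      | zero => simp
      | succ k ih =>
        rw [pow_succ, ih, pow_succ (B * A) k]
        simp only [mul_assoc]
    rw [h, trace_mul_comm, pow_succ]
    simp only [mul_assoc]

/-- The two claims feed each other in the induction. For the first, pass to X², rotate X²(X²)ᵀ
cyclically into (XᵀX)(XXᵀ), split by the second claim and finish with `two_mul_trace_mul_le`, whose
two right-hand traces agree. For the second, apply the first to X = AB and rotate into A²B². -/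
theorem trace_pow_two_pow_le_aux (k : ℕ) :
    (∀ X : Matrix J J ℝ, (X ^ 2 ^ (k + 1)).trace ≤ ((X * Xᵀ) ^ 2 ^ k).trace) ∧
    (∀ A B : Matrix J J ℝ, A.IsSymm → B.IsSymm →
      ((A * B) ^ 2 ^ k).trace ≤ (A ^ 2 ^ k * B ^ 2 ^ k).trace) := by
  induction k with
  | zero =>
    refine ⟨fun X => ?_, fun A B _ _ => by simp⟩
    have h := two_mul_trace_mul_le X X
    rw [trace_mul_comm Xᵀ X] at h
    simp only [zero_add, pow_one, pow_zero, pow_two]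
    linarith
  | succ k ih =>
    obtain ⟨ih1, ih2⟩ := ih
    constructor
    · intro X
      have hP : (Xᵀ * X).IsSymm := isSymm_transpose_mul_self X
      have hQ : (X * Xᵀ).IsSymm := isSymm_mul_transpose_self X
      have e1 : X ^ 2 ^ (k + 1 + 1) = (X ^ 2) ^ 2 ^ (k + 1) := by
        rw [← pow_mul, pow_succ' 2 (k + 1)]
      have e2 : ((X ^ 2 * (X ^ 2)ᵀ) ^ 2 ^ k).trace
          = (((Xᵀ * X) * (X * Xᵀ)) ^ 2 ^ k).trace := by
        have : X ^ 2 * (X ^ 2)ᵀ = X * (X * Xᵀ * Xᵀ) := by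
          rw [pow_two, transpose_mul]; simp only [mul_assoc]
        rw [this, trace_mul_pow_comm, trace_mul_pow_comm (Xᵀ * X)]
        simp only [mul_assoc]
      have h3 := two_mul_trace_mul_le ((Xᵀ * X) ^ 2 ^ k) ((X * Xᵀ) ^ 2 ^ k)
      rw [transpose_pow, transpose_pow, hP.eq, hQ.eq, ← pow_add, ← pow_add, ← two_mul, ← pow_succ',
        trace_mul_pow_comm Xᵀ X] at h3
      rw [e1]
      refine (ih1 _).trans ?_
      rw [e2]
      refine (ih2 _ _ hP hQ).trans ?_
      linarith
    · intro A B hA hB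
      refine (ih1 _).trans ?_
      have e : ((A * B * (A * B)ᵀ) ^ 2 ^ k).trace = ((A ^ 2 * B ^ 2) ^ 2 ^ k).trace := by
        rw [transpose_mul, hA.eq, hB.eq, pow_two, pow_two, mul_assoc A, trace_mul_pow_comm,
          trace_mul_pow_comm (A * A)]
        simp only [mul_assoc]
      rw [e]
      refine (ih2 _ _ (hA.pow 2) (hB.pow 2)).trans ?_
      rw [← pow_mul, ← pow_mul, ← pow_succ']

theorem norm_exp_le_exp_norm {𝔸 : Type*} [NormedRing 𝔸] [NormedAlgebra ℝ 𝔸] [CompleteSpace 𝔸]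
    [NormOneClass 𝔸] (Z : 𝔸) : ‖exp Z‖ ≤ Real.exp ‖Z‖ := by
  rw [exp_eq_tsum ℝ, Real.exp_eq_exp_ℝ]
  refine tsum_of_norm_bounded (exp_series_hasSum_exp' (𝕂 := ℝ) ‖Z‖) fun k => ?_
  rw [norm_smul, smul_eq_mul, Real.norm_of_nonneg (by positivity)]
  gcongr
  exact norm_pow_le _ _

/-- The **Lie product formula**. -/
theorem tendsto_exp_mul_exp_pow {𝔸 : Type*} [NormedRing 𝔸] [NormedAlgebra ℝ 𝔸] [CompleteSpace 𝔸]
    [NormOneClass 𝔸] (A B : 𝔸) :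
    Tendsto (fun N : ℕ => (exp ((N : ℝ)⁻¹ • A) * exp ((N : ℝ)⁻¹ • B)) ^ N) atTop
      (𝓝 (exp (A + B))) := by
  -- Telescoping bound, reducing the limit to N·‖X − Y‖ → 0 for the N-th roots X, Y.
  have hpow : ∀ (X Y : 𝔸) (M : ℝ), ‖X‖ ≤ M → ‖Y‖ ≤ M → ∀ N : ℕ,
      ‖X ^ N - Y ^ N‖ ≤ N * ‖X - Y‖ * M ^ (N - 1) := by
    intro X Y M hX hY N
    have hM : 0 ≤ M := (norm_nonneg X).trans hX
    induction N with
    | zero => simp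
    | succ N ih =>
      rcases N with _ | N
      · simp
      have e : X ^ (N + 1 + 1) - Y ^ (N + 1 + 1)
          = (X ^ (N + 1) - Y ^ (N + 1)) * X + Y ^ (N + 1) * (X - Y) := by
        rw [pow_succ X, pow_succ Y]; noncomm_ring
      rw [e]
      have h1 : ‖Y ^ (N + 1)‖ ≤ M ^ (N + 1) :=
        (norm_pow_le _ _).trans (pow_le_pow_left₀ (norm_nonneg _) hY _)
      calc _ ≤ ‖X ^ (N + 1) - Y ^ (N + 1)‖ * ‖X‖ + ‖Y ^ (N + 1)‖ * ‖X - Y‖ :=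
            (norm_add_le _ _).trans (add_le_add (norm_mul_le _ _) (norm_mul_le _ _))
        _ ≤ ((N + 1 : ℕ) * ‖X - Y‖ * M ^ (N + 1 - 1)) * M + M ^ (N + 1) * ‖X - Y‖ := by gcongr
        _ = _ := by simp only [Nat.add_sub_cancel]; push_cast; ring
  -- The two curves agree to first order at 0, so at t = 1/N their difference is o(1/N).
  have hd : HasDerivAt (fun t : ℝ => exp (t • A) * exp (t • B) - exp (t • (A + B))) 0 0 := by
    have h := ((hasDerivAt_exp_smul_const A (0 : ℝ)).mul
      (hasDerivAt_exp_smul_const B (0 : ℝ))).sub (hasDerivAt_exp_smul_const (A + B) (0 : ℝ))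
    simp only [zero_smul, exp_zero, one_mul, mul_one, sub_self] at h
    exact h
  have hslope := hd.tendsto_slope_zero
  have hinv : Tendsto (fun N : ℕ => (N : ℝ)⁻¹) atTop (𝓝[≠] 0) := by
    refine tendsto_nhdsWithin_iff.2 ⟨tendsto_inv_atTop_nhds_zero_nat, ?_⟩
    filter_upwards [eventually_gt_atTop 0] with N hN
    simpa using hN.ne'
  have hlim := (hslope.comp hinv).norm.mul_const (Real.exp (‖A‖ + ‖B‖))
  rw [norm_zero, zero_mul] at hlim
  rw [tendsto_iff_norm_sub_tendsto_zero]
  refine squeeze_zero' (Eventually.of_forall fun _ => norm_nonneg _) ?_ hlim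
  filter_upwards [eventually_gt_atTop 0] with N hN
  have hN' : (0 : ℝ) < N := by exact_mod_cast hN
  have hexp : ∀ Z : 𝔸, ‖exp Z‖ ≤ Real.exp ‖Z‖ := norm_exp_le_exp_norm
  have e : exp (A + B) = exp ((N : ℝ)⁻¹ • (A + B)) ^ N := by
    let _ : NormedAlgebra ℚ 𝔸 := NormedAlgebra.restrictScalars ℚ ℝ 𝔸
    rw [← NormedSpace.exp_nsmul, ← Nat.cast_smul_eq_nsmul ℝ, smul_smul, mul_inv_cancel₀ hN'.ne', one_smul]
  have hn : ∀ Z : 𝔸, ‖(N : ℝ)⁻¹ • Z‖ = (N : ℝ)⁻¹ * ‖Z‖ := fun Z => by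
    rw [norm_smul, Real.norm_of_nonneg (inv_nonneg.2 hN'.le)]
  have hX : ‖exp ((N : ℝ)⁻¹ • A) * exp ((N : ℝ)⁻¹ • B)‖ ≤ Real.exp ((N : ℝ)⁻¹ * (‖A‖ + ‖B‖)) := by
    rw [mul_add, Real.exp_add, ← hn, ← hn]
    exact (norm_mul_le _ _).trans (mul_le_mul (hexp _) (hexp _) (norm_nonneg _) (Real.exp_pos _).le)
  have hY : ‖exp ((N : ℝ)⁻¹ • (A + B))‖ ≤ Real.exp ((N : ℝ)⁻¹ * (‖A‖ + ‖B‖)) := by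
    refine (hexp _).trans (Real.exp_le_exp.2 ?_)
    rw [hn]
    gcongr
    exact norm_add_le _ _
  rw [e]
  refine (hpow _ _ _ hX hY N).trans ?_
  have hb : Real.exp ((N : ℝ)⁻¹ * (‖A‖ + ‖B‖)) ^ (N - 1) ≤ Real.exp (‖A‖ + ‖B‖) := by
    rw [← Real.exp_nat_mul]
    refine Real.exp_le_exp.2 ?_
    rw [← mul_assoc]
    refine mul_le_of_le_one_left (by positivity) ?_
    rw [← div_eq_mul_inv, div_le_one hN']
    exact_mod_cast Nat.sub_le N 1
  simp only [Function.comp_apply, zero_add, zero_smul, exp_zero, mul_one, sub_self, sub_zero,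
    inv_inv]
  rw [norm_smul, Real.norm_of_nonneg hN'.le]
  gcongr

/-- The **Golden–Thompson inequality** for real symmetric matrices. -/
theorem trace_exp_add_le {A B : Matrix J J ℝ} (hA : A.IsSymm) (hB : B.IsSymm) :
    (exp (A + B)).trace ≤ (exp A * exp B).trace := by
  cases isEmpty_or_nonempty J
  · simp [Matrix.trace]
  -- The trace inequality covers only exponents 2^k, so the limit is taken along this subsequence.
  have hlim := (tendsto_exp_mul_exp_pow A B).comp
    (tendsto_pow_atTop_atTop_of_one_lt (one_lt_two : (1 : ℕ) < 2))
  have htr : Continuous (fun M : Matrix J J ℝ => M.trace) := continuous_id.matrix_trace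
  refine le_of_tendsto ((htr.tendsto _).comp hlim) (Eventually.of_forall fun k => ?_)
  have hexp : ∀ Z : Matrix J J ℝ, exp (((2 ^ k : ℕ) : ℝ)⁻¹ • Z) ^ 2 ^ k = exp Z := fun Z => by
    rw [← Matrix.exp_nsmul, ← Nat.cast_smul_eq_nsmul ℝ, smul_smul, mul_inv_cancel₀ (by positivity),
      one_smul]
  have h := (trace_pow_two_pow_le_aux (J := J) k).2 _ _
    ((hA.smul (((2 ^ k : ℕ) : ℝ)⁻¹)).exp) ((hB.smul (((2 ^ k : ℕ) : ℝ)⁻¹)).exp)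
  rw [hexp, hexp] at h
  exact h

end GoldenThompson

/-! ### Spectral calculus and the exponential-trace tail bound for symmetric matrices. -/

section HermitianTail

open Matrix NormedSpace

variable {J : Type*} [Fintype J] [DecidableEq J]

theorem eq_conj_diagonal {Y : Matrix J J ℝ} (hY : Y.IsHermitian) :
    Y = (hY.eigenvectorUnitary : Matrix J J ℝ) * diagonal hY.eigenvalues *
      star (hY.eigenvectorUnitary : Matrix J J ℝ) := by
  have e := hY.spectral_theorem
  rwa [Unitary.conjStarAlgAut_apply] at e

theorem exp_conj_diagonal (W : unitaryGroup J ℝ) (d : J → ℝ) :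
    exp ((W : Matrix J J ℝ) * diagonal d * star (W : Matrix J J ℝ)) =
      (W : Matrix J J ℝ) * diagonal (fun i => Real.exp (d i)) * star (W : Matrix J J ℝ) := by
  refine (Matrix.exp_units_conj (Unitary.toUnits W) (diagonal d)).trans ?_
  rw [Matrix.exp_diagonal]
  change (W : Matrix J J ℝ) * diagonal (exp d) * star (W : Matrix J J ℝ) = _
  congr 3
  funext i
  rw [Pi.coe_exp, Real.exp_eq_exp_ℝ]

theorem trace_exp_eq {Y : Matrix J J ℝ} (hY : Y.IsHermitian) :
    (exp Y).trace = ∑ i, Real.exp (hY.eigenvalues i) := by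
  conv_lhs => rw [eq_conj_diagonal hY]
  rw [exp_conj_diagonal, trace_mul_cycle, Unitary.coe_star_mul_self, Matrix.one_mul,
    trace_diagonal]

theorem comb_conj_diagonal (W : unitaryGroup J ℝ) (d : J → ℝ) {Y : Matrix J J ℝ}
    (hY : Y = (W : Matrix J J ℝ) * diagonal d * star (W : Matrix J J ℝ)) (a b c e : ℝ) :
    a • (1 : Matrix J J ℝ) + b • Y + c • (Y * Y) + e • exp Y
      = (W : Matrix J J ℝ) * diagonal (fun i => a + b * d i + c * (d i * d i) + e * Real.exp (d i)) *
        star (W : Matrix J J ℝ) := by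
  have hu : star (W : Matrix J J ℝ) * (W : Matrix J J ℝ) = 1 := Unitary.coe_star_mul_self _
  have hu' : (W : Matrix J J ℝ) * star (W : Matrix J J ℝ) = 1 := Unitary.coe_mul_star_self _
  have e2 : Y * Y = (W : Matrix J J ℝ) * diagonal (fun i => d i * d i) *
      star (W : Matrix J J ℝ) := by
    rw [← diagonal_mul_diagonal, hY]
    calc _ = (W : Matrix J J ℝ) * diagonal d * (star (W : Matrix J J ℝ) * W) * diagonal d *
            star (W : Matrix J J ℝ) := by simp only [Matrix.mul_assoc]
      _ = _ := by rw [hu]; simp only [Matrix.mul_assoc, Matrix.one_mul]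
  have hd : diagonal (fun i => a + b * d i + c * (d i * d i) + e * Real.exp (d i)) =
      a • (1 : Matrix J J ℝ) + b • diagonal d + c • diagonal (fun i => d i * d i) +
        e • diagonal (fun i => Real.exp (d i)) := by
    rw [← diagonal_one, ← diagonal_smul, ← diagonal_smul, ← diagonal_smul, ← diagonal_smul,
      diagonal_add, diagonal_add, diagonal_add]
    congr 1
    funext i
    simp
  rw [e2, hd, hY, exp_conj_diagonal]
  simp only [Matrix.mul_add, Matrix.add_mul, Matrix.mul_smul, Matrix.smul_mul, Matrix.mul_one, hu']

/-- A single eigenbasis diagonalises 1, Y, Y² and exp Y together, so the operator inequalities in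
one matrix needed below become scalar ones through a choice of coefficients. -/
theorem posSemidef_comb_iff {Y : Matrix J J ℝ} (hY : Y.IsHermitian) (a b c d : ℝ) :
    (a • (1 : Matrix J J ℝ) + b • Y + c • (Y * Y) + d • exp Y).PosSemidef ↔
      ∀ i, 0 ≤ a + b * hY.eigenvalues i + c * (hY.eigenvalues i * hY.eigenvalues i)
        + d * Real.exp (hY.eigenvalues i) := by
  have hu : IsUnit (hY.eigenvectorUnitary : Matrix J J ℝ) :=
    (Unitary.toUnits hY.eigenvectorUnitary).isUnit
  rw [comb_conj_diagonal _ _ (eq_conj_diagonal hY), hu.posSemidef_star_right_conjugate_iff, posSemidef_diagonal_iff]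

theorem posSemidef_smul_one_sub_iff {Y : Matrix J J ℝ} (hY : Y.IsHermitian) (t : ℝ) :
    (t • (1 : Matrix J J ℝ) - Y).PosSemidef ↔ ∀ i, hY.eigenvalues i ≤ t := by
  have h := posSemidef_comb_iff hY t (-1) 0 0
  simpa [sub_eq_add_neg] using h

/-- The scalar bound e^y ≤ 1 + y + y² on [−1, 1], applied to the eigenvalues. -/
theorem posSemidef_one_add_add_sq_sub_exp {Y : Matrix J J ℝ} (hY : Y.IsHermitian)
    (h1 : (1 - Y).PosSemidef) (h2 : (1 + Y).PosSemidef) :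
    (1 + Y + Y * Y - exp Y).PosSemidef := by
  have g1 := (posSemidef_comb_iff hY 1 (-1) 0 0).1 (by simpa [sub_eq_add_neg] using h1)
  have g2 := (posSemidef_comb_iff hY 1 1 0 0).1 (by simpa using h2)
  have h := (posSemidef_comb_iff hY 1 1 1 (-1)).2 fun i => by
    have g1 := g1 i
    have g2 := g2 i
    have := Real.abs_exp_sub_one_sub_id_le (x := hY.eigenvalues i)
      (abs_le.2 ⟨by linarith, by linarith⟩)
    have := (abs_le.1 this).2
    nlinarith
  simpa [sub_eq_add_neg] using h

theorem posSemidef_exp {Y : Matrix J J ℝ} (hY : Y.IsHermitian) : (exp Y).PosSemidef := by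
  have h := (posSemidef_comb_iff hY 0 0 0 1).2 fun i => by
    simpa using (Real.exp_pos _).le
  simpa using h

/-- Some eigenvalue exceeds t, and the other terms of the trace are positive. This is the pointwise
form of the exponential Markov inequality. -/
theorem exp_le_trace_exp_of_not_posSemidef {Y : Matrix J J ℝ} (hY : Y.IsHermitian) {t : ℝ}
    (h : ¬ (t • (1 : Matrix J J ℝ) - Y).PosSemidef) : Real.exp t ≤ (exp Y).trace := by
  rw [posSemidef_smul_one_sub_iff hY] at h
  push Not at h
  obtain ⟨i, hi⟩ := h
  rw [trace_exp_eq hY]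
  exact (Real.exp_le_exp.2 hi.le).trans
    (Finset.single_le_sum (f := fun i => Real.exp (hY.eigenvalues i))
      (fun _ _ => (Real.exp_pos _).le) (Finset.mem_univ i))

theorem trace_mul_nonneg {A B : Matrix J J ℝ} (hA : A.PosSemidef) (hB : B.PosSemidef) :
    0 ≤ (A * B).trace := by
  rw [eq_conj_diagonal hA.1, Matrix.mul_assoc, Matrix.mul_assoc, trace_mul_comm, Matrix.mul_assoc]
  refine Finset.sum_nonneg fun i _ => ?_
  rw [diag_apply, diagonal_mul]
  exact mul_nonneg (hA.eigenvalues_nonneg i) (hB.conjTranspose_mul_mul_same _).diag_nonneg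

variable {I : Type*} [Fintype I]

/-- Golden–Thompson splits off one sample; summing over it replaces its exponential by at most c·1,
since the remaining factor is positive semidefinite. Each sample thus costs a factor c. -/
theorem sum_trace_exp_sum_le {Y : I → Matrix J J ℝ} (hY : ∀ i, (Y i).IsHermitian) {c : ℝ}
    (hc0 : 0 ≤ c) (hc : (c • (1 : Matrix J J ℝ) - ∑ i, exp (Y i)).PosSemidef) (m : ℕ) :
    ∑ w : Fin m → I, (exp (∑ k, Y (w k))).trace ≤ Fintype.card J * c ^ m := by
  induction m with
  | zero => simp
  | succ m ih =>
    have hs : ∀ w : Fin m → I, (∑ k, Y (w k)).IsHermitian := fun w =>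
      isSelfAdjoint_sum _ fun k _ => hY _
    have hsy : ∀ {Z : Matrix J J ℝ}, Z.IsHermitian → Z.IsSymm := fun h => by
      rwa [isHermitian_iff_isSymm] at h
    calc ∑ w : Fin (m + 1) → I, (exp (∑ k, Y (w k))).trace
        = ∑ w : Fin m → I, ∑ i, (exp (∑ k, Y (w k) + Y i)).trace := by
          rw [← (Fin.consEquiv fun _ : Fin (m + 1) => I).sum_comp, Fintype.sum_prod_type,
            Finset.sum_comm]
          refine Finset.sum_congr rfl fun w _ => Finset.sum_congr rfl fun i _ => ?_
          rw [Fin.sum_univ_succ, add_comm]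
          simp [Fin.consEquiv]
      _ ≤ ∑ w : Fin m → I, ∑ i, (exp (∑ k, Y (w k)) * exp (Y i)).trace :=
          Finset.sum_le_sum fun w _ => Finset.sum_le_sum fun i _ =>
            trace_exp_add_le (hsy (hs w)) (hsy (hY i))
      _ ≤ ∑ w : Fin m → I, c * (exp (∑ k, Y (w k))).trace := by
          refine Finset.sum_le_sum fun w _ => ?_
          have h := trace_mul_nonneg (posSemidef_exp (hs w)) hc
          rw [Matrix.mul_sub, trace_sub, Matrix.mul_smul, trace_smul, Matrix.mul_one,
            smul_eq_mul, Matrix.mul_sum, trace_sum] at h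
          linarith
      _ ≤ Fintype.card J * c ^ (m + 1) := by
          rw [← Finset.mul_sum, pow_succ]
          nlinarith [mul_le_mul_of_nonneg_left ih hc0]

-- Centring removes the linear term of 1 + Y + Y², so the exponentials sum to at most |I|(1 + v) ≤
-- |I|e^v, which serves as c in `sum_trace_exp_sum_le`.
open Classical in
theorem card_not_posSemidef_mul_exp_le {Y : I → Matrix J J ℝ} (hY : ∀ i, (Y i).IsHermitian)
    (h0 : ∑ i, Y i = 0) (h1 : ∀ i, (1 - Y i).PosSemidef) (h2 : ∀ i, (1 + Y i).PosSemidef) {v : ℝ}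
    (hv : ((Fintype.card I * v) • (1 : Matrix J J ℝ) - ∑ i, Y i * Y i).PosSemidef) (m : ℕ) (t : ℝ) :
    (Finset.univ.filter fun w : Fin m → I =>
        ¬ (t • (1 : Matrix J J ℝ) - ∑ k, Y (w k)).PosSemidef).card * Real.exp t ≤
      Fintype.card J * (Fintype.card I * Real.exp v) ^ m := by
  have hs : ∀ w : Fin m → I, (∑ k, Y (w k)).IsHermitian := fun w =>
    isSelfAdjoint_sum _ fun k _ => hY _
  refine le_trans ?_ (sum_trace_exp_sum_le hY (by positivity) ?_ m)
  · rw [← nsmul_eq_mul, ← Finset.sum_const]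
    refine (Finset.sum_le_sum fun w hw => exp_le_trace_exp_of_not_posSemidef (hs w)
      (Finset.mem_filter.1 hw).2).trans ?_
    exact Finset.sum_le_sum_of_subset_of_nonneg (Finset.subset_univ _) fun w _ _ =>
      (posSemidef_exp (hs w)).trace_nonneg
  · have ha : (∑ i, (1 + Y i + Y i * Y i - exp (Y i))).PosSemidef :=
      posSemidef_sum _ fun i _ => posSemidef_one_add_add_sq_sub_exp (hY i) (h1 i) (h2 i)
    have hb : ((Fintype.card I * (Real.exp v - 1 - v)) • (1 : Matrix J J ℝ)).PosSemidef :=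
      PosSemidef.one.smul (mul_nonneg (Nat.cast_nonneg _)
        (by linarith [Real.add_one_le_exp v]))
    have h := (ha.add hv).add hb
    convert h using 1
    simp only [Finset.sum_sub_distrib, Finset.sum_add_distrib, h0, Finset.sum_const,
      Finset.card_univ, ← Nat.cast_smul_eq_nsmul ℝ]
    module

end HermitianTail

/-! ### Bernstein inequality for non-symmetric operators, by dilation. -/

section Bernstein

open Matrix ContinuousLinearMap

variable {J : Type*} [Fintype J] [DecidableEq J]

/-- The matrix of the self-adjoint dilation of an operator on a Euclidean space. -/
noncomputable def dilation (T : EuclideanSpace ℝ J →L[ℝ] EuclideanSpace ℝ J) :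
    Matrix (J ⊕ J) (J ⊕ J) ℝ :=
  fromBlocks 0 ((toEuclideanCLM (𝕜 := ℝ)).symm T) ((toEuclideanCLM (𝕜 := ℝ)).symm T)ᵀ 0

theorem isHermitian_dilation (T : EuclideanSpace ℝ J →L[ℝ] EuclideanSpace ℝ J) :
    (dilation T).IsHermitian := by
  simp [dilation, Matrix.IsHermitian, conjTranspose_eq_transpose_of_trivial, fromBlocks_transpose]

theorem dilation_sum {ι : Type*} (s : Finset ι)
    (T : ι → EuclideanSpace ℝ J →L[ℝ] EuclideanSpace ℝ J) :
    dilation (∑ i ∈ s, T i) = ∑ i ∈ s, dilation (T i) := by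
  classical
  induction s using Finset.induction_on with
  | empty => simp [dilation]
  | insert i s hi ih =>
    rw [Finset.sum_insert hi, Finset.sum_insert hi, ← ih]
    simp [dilation, fromBlocks_add, transpose_add]

theorem dilation_neg (T : EuclideanSpace ℝ J →L[ℝ] EuclideanSpace ℝ J) :
    dilation (-T) = -dilation T := by
  simp [dilation, fromBlocks_neg, transpose_neg]

theorem dotProduct_symm_mulVec (T : EuclideanSpace ℝ J →L[ℝ] EuclideanSpace ℝ J) (x y : J → ℝ) :
    x ⬝ᵥ ((toEuclideanCLM (𝕜 := ℝ)).symm T *ᵥ y) = inner ℝ (WithLp.toLp 2 x) (T (WithLp.toLp 2 y)) := by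
  have h := inner_toEuclideanCLM ((toEuclideanCLM (𝕜 := ℝ)).symm T) (WithLp.toLp 2 x)
    (WithLp.toLp 2 y)
  rw [StarAlgEquiv.apply_symm_apply] at h
  exact h.symm

omit [DecidableEq J] in
theorem dotProduct_self_eq_norm_sq (x : J → ℝ) : x ⬝ᵥ x = ‖WithLp.toLp 2 x‖ ^ 2 := by
  rw [EuclideanSpace.real_norm_sq_eq]
  exact Finset.sum_congr rfl fun i _ => (pow_two _).symm

theorem dotProduct_dilation_mulVec (T : EuclideanSpace ℝ J →L[ℝ] EuclideanSpace ℝ J)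
    (x y : J → ℝ) :
    Sum.elim x y ⬝ᵥ (dilation T *ᵥ Sum.elim x y) =
      2 * inner ℝ (WithLp.toLp 2 x) (T (WithLp.toLp 2 y)) := by
  rw [dilation, fromBlocks_mulVec]
  simp only [Sum.elim_comp_inl, Sum.elim_comp_inr, Matrix.zero_mulVec, zero_add, add_zero,
    sumElim_dotProduct_sumElim]
  rw [dotProduct_symm_mulVec, mulVec_transpose, dotProduct_comm y, ← dotProduct_mulVec,
    dotProduct_symm_mulVec]
  ring

/-- The square of the dilation is block diagonal with blocks TTᵀ and TᵀT, which is why both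
variances, of T and of its adjoint, must be bounded. -/
theorem dotProduct_dilation_mul_dilation_mulVec
    (T : EuclideanSpace ℝ J →L[ℝ] EuclideanSpace ℝ J) (x y : J → ℝ) :
    Sum.elim x y ⬝ᵥ ((dilation T * dilation T) *ᵥ Sum.elim x y) =
      ‖adjoint T (WithLp.toLp 2 x)‖ ^ 2 + ‖T (WithLp.toLp 2 y)‖ ^ 2 := by
  have hst : ((toEuclideanCLM (𝕜 := ℝ)).symm T)ᵀ = (toEuclideanCLM (𝕜 := ℝ)).symm (adjoint T) := by
    have h := (toEuclideanCLM (𝕜 := ℝ) (n := J)).symm.map_star' T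
    rw [star_eq_conjTranspose, conjTranspose_eq_transpose_of_trivial] at h
    exact h.symm
  rw [dilation, fromBlocks_multiply, fromBlocks_mulVec]
  simp only [Sum.elim_comp_inl, Sum.elim_comp_inr, Matrix.zero_mulVec, zero_add, add_zero,
    sumElim_dotProduct_sumElim, Matrix.zero_mul, Matrix.mul_zero]
  rw [hst, ← map_mul, ← map_mul, dotProduct_symm_mulVec, dotProduct_symm_mulVec,
    ← real_inner_self_eq_norm_sq, ← real_inner_self_eq_norm_sq]
  congr 1
  · exact (adjoint_inner_left T _ _).symm
  · exact adjoint_inner_right T _ _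

omit [DecidableEq J] in
theorem posSemidef_of_sumElim {M : Matrix (J ⊕ J) (J ⊕ J) ℝ} (hM : M.IsHermitian)
    (h : ∀ x y : J → ℝ, 0 ≤ Sum.elim x y ⬝ᵥ (M *ᵥ Sum.elim x y)) : M.PosSemidef := by
  refine PosSemidef.of_dotProduct_mulVec_nonneg hM fun z => ?_
  have := h (z ∘ Sum.inl) (z ∘ Sum.inr)
  rwa [Sum.elim_comp_inl_inr] at this

omit [Fintype J] in
theorem isHermitian_smul_one_sub {M : Matrix J J ℝ} (hM : M.IsHermitian) (c : ℝ) :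
    (c • (1 : Matrix J J ℝ) - M).IsHermitian := by
  refine IsHermitian.sub ?_ hM
  rw [Matrix.IsHermitian, conjTranspose_smul, conjTranspose_one, star_trivial]

theorem posSemidef_sub_dilation_of_norm_le {T : EuclideanSpace ℝ J →L[ℝ] EuclideanSpace ℝ J}
    {t : ℝ} (h : ‖T‖ ≤ t) : (t • (1 : Matrix (J ⊕ J) (J ⊕ J) ℝ) - dilation T).PosSemidef := by
  refine posSemidef_of_sumElim (isHermitian_smul_one_sub (isHermitian_dilation T) t) fun x y => ?_
  rw [Matrix.sub_mulVec, dotProduct_sub, dotProduct_dilation_mulVec, Matrix.smul_mulVec,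
    Matrix.one_mulVec, dotProduct_smul, sumElim_dotProduct_sumElim, dotProduct_self_eq_norm_sq,
    dotProduct_self_eq_norm_sq, smul_eq_mul]
  set u := WithLp.toLp 2 x
  set z := WithLp.toLp 2 y
  have h1 : inner ℝ u (T z) ≤ t * (‖u‖ * ‖z‖) := by
    calc inner ℝ u (T z) ≤ ‖u‖ * ‖T z‖ := real_inner_le_norm _ _
      _ ≤ ‖u‖ * (t * ‖z‖) := by
          gcongr
          exact (T.le_opNorm z).trans (by gcongr)
      _ = _ := by ring
  have ht : 0 ≤ t := (norm_nonneg _).trans h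
  nlinarith [mul_nonneg ht (sq_nonneg (‖u‖ - ‖z‖))]

theorem norm_le_of_posSemidef_sub_dilation {T : EuclideanSpace ℝ J →L[ℝ] EuclideanSpace ℝ J}
    {t : ℝ} (ht : 0 < t) (h : (t • (1 : Matrix (J ⊕ J) (J ⊕ J) ℝ) - dilation T).PosSemidef) :
    ‖T‖ ≤ t := by
  refine T.opNorm_le_bound ht.le fun z => ?_
  -- For fixed z, the first block u = t⁻¹Tz minimises t‖u‖² − 2⟨u, Tz⟩.
  have h1 := h.dotProduct_mulVec_nonneg (Sum.elim (t⁻¹ • T z).ofLp z.ofLp)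
  rw [star_trivial, Matrix.sub_mulVec, dotProduct_sub, dotProduct_dilation_mulVec,
    Matrix.smul_mulVec,
    Matrix.one_mulVec, dotProduct_smul, sumElim_dotProduct_sumElim, dotProduct_self_eq_norm_sq,
    dotProduct_self_eq_norm_sq, smul_eq_mul, WithLp.toLp_ofLp, WithLp.toLp_ofLp, norm_smul,
    real_inner_smul_left, real_inner_self_eq_norm_sq, Real.norm_of_nonneg (by positivity)] at h1
  have h2 : ‖T z‖ ^ 2 ≤ (t * ‖z‖) ^ 2 := by
    have e : t * (t * ((t⁻¹ * ‖T z‖) ^ 2 + ‖z‖ ^ 2) - 2 * (t⁻¹ * ‖T z‖ ^ 2))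
        = (t * ‖z‖) ^ 2 - ‖T z‖ ^ 2 := by
      field_simp
      ring
    have := mul_nonneg ht.le h1
    linarith
  exact le_of_sq_le_sq h2 (by positivity)

variable {I : Type*} [Fintype I]

open Classical in
/-- A counting form of the noncommutative **Bernstein inequality** for independent samples, drawn
with replacement from a finite family of operators. -/
theorem card_lt_norm_sum_mul_exp_le {T : I → EuclideanSpace ℝ J →L[ℝ] EuclideanSpace ℝ J}
    (h0 : ∑ i, T i = 0) (h1 : ∀ i, ‖T i‖ ≤ 1) {v : ℝ}
    (hv : ∀ x, ∑ i, ‖T i x‖ ^ 2 ≤ Fintype.card I * v * ‖x‖ ^ 2)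
    (hv' : ∀ x, ∑ i, ‖adjoint (T i) x‖ ^ 2 ≤ Fintype.card I * v * ‖x‖ ^ 2) (m : ℕ)
    {t : ℝ} (ht : 0 < t) :
    (Finset.univ.filter fun w : Fin m → I => t < ‖∑ k, T (w k)‖).card * Real.exp t ≤
      2 * Fintype.card J * (Fintype.card I * Real.exp v) ^ m := by
  have h := card_not_posSemidef_mul_exp_le (Y := fun i => dilation (T i))
    (fun i => isHermitian_dilation _) (by rw [← dilation_sum, h0]; simp [dilation])
    (fun i => by simpa using posSemidef_sub_dilation_of_norm_le (h1 i))
    (fun i => by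
      simpa [dilation_neg] using posSemidef_sub_dilation_of_norm_le (T := -T i) (t := 1)
        (by simpa using h1 i))
    (v := v)
    (by
      refine posSemidef_of_sumElim (isHermitian_smul_one_sub
        (isSelfAdjoint_sum _ fun i _ => ?_) _) fun x y => ?_
      · have := (isHermitian_dilation (T i)).pow 2
        rwa [pow_two] at this
      · rw [Matrix.sub_mulVec, dotProduct_sub, Matrix.smul_mulVec, Matrix.one_mulVec,
          dotProduct_smul, sumElim_dotProduct_sumElim, dotProduct_self_eq_norm_sq,
          dotProduct_self_eq_norm_sq, smul_eq_mul, Matrix.sum_mulVec, dotProduct_sum]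
        simp only [dotProduct_dilation_mul_dilation_mulVec, Finset.sum_add_distrib]
        have := hv (WithLp.toLp 2 y)
        have := hv' (WithLp.toLp 2 x)
        linarith) m t
  -- The dilation doubles the dimension; hence the factor 2.
  rw [Fintype.card_sum] at h
  push_cast at h
  rw [two_mul]
  refine le_trans ?_ h
  gcongr with w
  intro hw hP
  rw [← dilation_sum] at hP
  exact hw.not_ge (norm_le_of_posSemidef_sub_dilation ht hP)

end Bernstein

/-! ### Range, variance and tail of the centred coordinate samples. -/

section CoordinateSampling

open ContinuousLinearMap InnerProductSpace

variable {J : Type*} [Fintype J] [DecidableEq J]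

/-- The centred contribution of a sample `p` to the sampling of coordinates between the operators
`A` and `B`. -/
noncomputable def centredSample (A B : EuclideanSpace ℝ J →L[ℝ] EuclideanSpace ℝ J) (p : J) :
    EuclideanSpace ℝ J →L[ℝ] EuclideanSpace ℝ J :=
  (Fintype.card J : ℝ) • rankOne ℝ (A (EuclideanSpace.single p 1)) (B (EuclideanSpace.single p 1))
    - A ∘L B

theorem inner_apply_single {B : EuclideanSpace ℝ J →L[ℝ] EuclideanSpace ℝ J}
    (hB : IsSelfAdjoint B) (p : J) (x : EuclideanSpace ℝ J) :
    inner ℝ (B (EuclideanSpace.single p 1)) x = B x p := by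
  have h := hB.isSymmetric (EuclideanSpace.single p 1) x
  simp only [coe_coe] at h
  rw [h, EuclideanSpace.inner_single_left]
  simp

theorem rankOne_apply_single {B : EuclideanSpace ℝ J →L[ℝ] EuclideanSpace ℝ J}
    (hB : IsSelfAdjoint B) (A : EuclideanSpace ℝ J →L[ℝ] EuclideanSpace ℝ J) (p : J)
    (x : EuclideanSpace ℝ J) :
    rankOne ℝ (A (EuclideanSpace.single p 1)) (B (EuclideanSpace.single p 1)) x
      = A (EuclideanSpace.single p (B x p)) := by
  rw [rankOne_apply, inner_apply_single hB, ← map_smul]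
  congr 1
  ext q
  by_cases h : q = p <;> simp [h]

theorem sum_single_apply (x : EuclideanSpace ℝ J) : ∑ p, EuclideanSpace.single p (x p) = x := by
  ext q
  simp [Finset.sum_apply, Pi.single_apply]

theorem sum_rankOne_eq {B : EuclideanSpace ℝ J →L[ℝ] EuclideanSpace ℝ J}
    (hB : IsSelfAdjoint B) (A : EuclideanSpace ℝ J →L[ℝ] EuclideanSpace ℝ J) :
    ∑ p, rankOne ℝ (A (EuclideanSpace.single p 1)) (B (EuclideanSpace.single p 1)) = A ∘L B := by
  ext1 x
  rw [sum_apply]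
  simp only [rankOne_apply_single hB, ← map_sum, sum_single_apply, comp_apply]

theorem sum_centredSample {B : EuclideanSpace ℝ J →L[ℝ] EuclideanSpace ℝ J}
    (hB : IsSelfAdjoint B) (A : EuclideanSpace ℝ J →L[ℝ] EuclideanSpace ℝ J) :
    ∑ p, centredSample A B p = 0 := by
  simp only [centredSample]
  rw [Finset.sum_sub_distrib, ← Finset.smul_sum, sum_rankOne_eq hB, Finset.sum_const,
    Finset.card_univ, Nat.cast_smul_eq_nsmul, sub_self]

theorem adjoint_centredSample {A B : EuclideanSpace ℝ J →L[ℝ] EuclideanSpace ℝ J}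
    (hA : IsSelfAdjoint A) (hB : IsSelfAdjoint B) (p : J) :
    adjoint (centredSample A B p) = centredSample B A p := by
  rw [centredSample, centredSample, map_sub, LinearIsometryEquiv.map_smulₛₗ, adjoint_rankOne, adjoint_comp,
    hA.adjoint_eq, hB.adjoint_eq]
  simp

/-- The mean AB is itself a sum of |J| rank-one operators of norm at most c, so both terms of the
difference are at most |J|c. -/
theorem norm_centredSample_le {A B : EuclideanSpace ℝ J →L[ℝ] EuclideanSpace ℝ J}
    (hB : IsSelfAdjoint B) {c : ℝ}
    (hc : ∀ p, ‖A (EuclideanSpace.single p 1)‖ * ‖B (EuclideanSpace.single p 1)‖ ≤ c) (p : J) :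
    ‖centredSample A B p‖ ≤ 2 * (Fintype.card J * c) := by
  refine (norm_sub_le _ _).trans ?_
  rw [two_mul]
  gcongr
  · rw [norm_smul, norm_rankOne, Real.norm_natCast]
    gcongr
    exact hc p
  · rw [← sum_rankOne_eq hB, ← nsmul_eq_mul, ← Finset.card_univ]
    rw [← Finset.sum_const]
    exact norm_sum_le_of_le _ fun q _ => by rw [norm_rankOne]; exact hc q

-- Variance is at most second moment: the two sides differ by |J|·‖∑ g‖².
omit [DecidableEq J] in
theorem sum_norm_sq_smul_sub_sum_le {E : Type*} [NormedAddCommGroup E] [InnerProductSpace ℝ E]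
    (g : J → E) :
    ∑ p, ‖(Fintype.card J : ℝ) • g p - ∑ q, g q‖ ^ 2 ≤
      (Fintype.card J : ℝ) ^ 2 * ∑ p, ‖g p‖ ^ 2 := by
  have h : ∀ p, ‖(Fintype.card J : ℝ) • g p - ∑ q, g q‖ ^ 2 = (Fintype.card J : ℝ) ^ 2 * ‖g p‖ ^ 2
      - 2 * Fintype.card J * inner ℝ (g p) (∑ q, g q) + ‖∑ q, g q‖ ^ 2 := fun p => by
    rw [norm_sub_sq_real, norm_smul, real_inner_smul_left, Real.norm_natCast]
    ring
  simp only [h]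
  rw [Finset.sum_add_distrib, Finset.sum_sub_distrib, ← Finset.mul_sum, ← Finset.mul_sum,
    ← sum_inner, real_inner_self_eq_norm_sq, Finset.sum_const, Finset.card_univ, nsmul_eq_mul]
  have : (0 : ℝ) ≤ Fintype.card J * ‖∑ q, g q‖ ^ 2 := by positivity
  linarith

/-- After dropping the mean, the p-th term is ‖A e_p‖²·|(Bx)_p|², and the coordinates of Bx sum in
square to ‖Bx‖² ≤ ‖x‖². -/
theorem sum_norm_sq_centredSample_le {A B : EuclideanSpace ℝ J →L[ℝ] EuclideanSpace ℝ J}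
    (hB : IsSelfAdjoint B) (hB1 : ‖B‖ ≤ 1) {a : ℝ} (ha0 : 0 ≤ a)
    (ha : ∀ p, ‖A (EuclideanSpace.single p 1)‖ ^ 2 ≤ a) (x : EuclideanSpace ℝ J) :
    ∑ p, ‖centredSample A B p x‖ ^ 2 ≤
      Fintype.card J * (Fintype.card J * a) * ‖x‖ ^ 2 := by
  have h := sum_norm_sq_smul_sub_sum_le fun p =>
    rankOne ℝ (A (EuclideanSpace.single p 1)) (B (EuclideanSpace.single p 1)) x
  rw [← sum_apply, sum_rankOne_eq hB] at h
  refine h.trans ?_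
  have h1 : ∑ p, ‖rankOne ℝ (A (EuclideanSpace.single p 1)) (B (EuclideanSpace.single p 1)) x‖ ^ 2
      ≤ a * ‖B x‖ ^ 2 := by
    rw [EuclideanSpace.real_norm_sq_eq, Finset.mul_sum]
    refine Finset.sum_le_sum fun p _ => ?_
    rw [rankOne_apply, inner_apply_single hB, norm_smul, mul_pow, Real.norm_eq_abs, sq_abs,
      mul_comm]
    gcongr
    exact ha p
  have h2 : ‖B x‖ ≤ ‖x‖ := (B.le_of_opNorm_le hB1 x).trans (one_mul _).le
  calc _ ≤ (Fintype.card J : ℝ) ^ 2 * (a * ‖x‖ ^ 2) := by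
        gcongr
        exact h1.trans (by gcongr)
    _ = _ := by ring

open Classical in
/-- The operators `A` and `B` have coordinate images of norm at most `√a` and `√b`; `L` dominates
the range and the variance of the centred samples. -/
theorem card_lt_norm_sum_centredSample_le [Nonempty J]
    {A B : EuclideanSpace ℝ J →L[ℝ] EuclideanSpace ℝ J}
    (hA : IsSelfAdjoint A) (hB : IsSelfAdjoint B) (hA1 : ‖A‖ ≤ 1) (hB1 : ‖B‖ ≤ 1) {a b L τ : ℝ}
    (ha : ∀ p, ‖A (EuclideanSpace.single p 1)‖ ^ 2 ≤ a)
    (hb : ∀ p, ‖B (EuclideanSpace.single p 1)‖ ^ 2 ≤ b)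
    (haL : Fintype.card J * a ≤ L) (hbL : Fintype.card J * b ≤ L)
    (habL : 4 * Fintype.card J ^ 2 * (a * b) ≤ L ^ 2)
    (hL : 0 < L) (hτ : 0 < τ) (hτ2 : τ ≤ 2) {m : ℕ} (hm : 0 < m) :
    ((Finset.univ.filter fun w : Fin m → J =>
      τ < ‖(m : ℝ)⁻¹ • ∑ k, centredSample A B (w k)‖).card : ℝ) ≤
      2 * Fintype.card J * Real.exp (-(m * τ ^ 2 / (4 * L))) * Fintype.card J ^ m := by
  have p0 : J := Classical.arbitrary J
  have ha0 : 0 ≤ a := (sq_nonneg _).trans (ha p0)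
  have hb0 : 0 ≤ b := (sq_nonneg _).trans (hb p0)
  have hm' : (0 : ℝ) < m := by exact_mod_cast hm
  -- Minimiser of θ²L − θτ, with value −τ²/(4L). The range condition θL ≤ 1 is exactly τ ≤ 2.
  set θ : ℝ := τ / (2 * L) with hθ
  have hθ0 : 0 < θ := by positivity
  have hnorm : ∀ p, ‖centredSample A B p‖ ≤ L := fun p => by
    have h1 : ∀ p, ‖A (EuclideanSpace.single p 1)‖ * ‖B (EuclideanSpace.single p 1)‖ ≤ √(a * b) :=
      fun p => Real.le_sqrt_of_sq_le (by
        rw [mul_pow]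
        exact mul_le_mul (ha p) (hb p) (sq_nonneg _) ha0)
    refine (norm_centredSample_le hB h1 p).trans (le_of_sq_le_sq ?_ hL.le)
    rw [mul_pow, mul_pow, Real.sq_sqrt (mul_nonneg ha0 hb0)]
    linarith
  have hvar : ∀ {A B : EuclideanSpace ℝ J →L[ℝ] EuclideanSpace ℝ J} {a : ℝ},
      IsSelfAdjoint B → ‖B‖ ≤ 1 → 0 ≤ a → (∀ p, ‖A (EuclideanSpace.single p 1)‖ ^ 2 ≤ a) →
      Fintype.card J * a ≤ L → ∀ x, ∑ p, ‖(θ • centredSample A B p) x‖ ^ 2 ≤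
        Fintype.card J * (θ ^ 2 * L) * ‖x‖ ^ 2 := by
    intro A B a hB hB1 ha0 ha haL x
    simp only [smul_apply, norm_smul, mul_pow, Real.norm_eq_abs, sq_abs]
    rw [← Finset.mul_sum]
    calc _ ≤ θ ^ 2 * (Fintype.card J * (Fintype.card J * a) * ‖x‖ ^ 2) := by
          gcongr
          exact sum_norm_sq_centredSample_le hB hB1 ha0 ha x
      _ ≤ θ ^ 2 * (Fintype.card J * L * ‖x‖ ^ 2) := by gcongr
      _ = _ := by ring
  have h := card_lt_norm_sum_mul_exp_le (T := fun p => θ • centredSample A B p)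
    (by rw [← Finset.smul_sum, sum_centredSample hB, smul_zero])
    (fun p => by
      rw [norm_smul, Real.norm_of_nonneg hθ0.le]
      calc θ * _ ≤ θ * L := by gcongr; exact hnorm p
        _ ≤ 1 := by rw [hθ]; field_simp; linarith)
    (hvar hB hB1 ha0 ha haL)
    -- Taking adjoints exchanges A and B, so the same variance bound applies with a replaced by b.
    (fun x => by
      have := hvar hA hA1 hb0 hb hbL x
      simpa only [LinearIsometryEquiv.map_smulₛₗ, adjoint_centredSample hA hB, conj_trivial] using this)
    m (t := θ * m * τ) (by positivity)
  have hset : (Finset.univ.filter fun w : Fin m → J =>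
      τ < ‖(m : ℝ)⁻¹ • ∑ k, centredSample A B (w k)‖) = Finset.univ.filter fun w : Fin m → J =>
      θ * m * τ < ‖∑ k, θ • centredSample A B (w k)‖ := by
    refine Finset.filter_congr fun w _ => ?_
    rw [← Finset.smul_sum, norm_smul, norm_smul, Real.norm_of_nonneg hθ0.le, mul_assoc,
      mul_lt_mul_iff_right₀ hθ0, Real.norm_of_nonneg (inv_nonneg.2 hm'.le), inv_mul_eq_div,
      lt_div_iff₀' hm']
  rw [← le_div_iff₀ (Real.exp_pos _)] at h
  rw [hset]
  refine h.trans (le_of_eq ?_)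
  rw [div_eq_mul_inv, ← Real.exp_neg, mul_pow, ← Real.exp_nat_mul]
  have e : Real.exp (-(m * τ ^ 2 / (4 * L))) =
      Real.exp (m * (θ ^ 2 * L)) * Real.exp (-(θ * m * τ)) := by
    rw [← Real.exp_add, hθ]
    congr 1
    field_simp
    ring
  rw [e]
  ring

end CoordinateSampling

/-! ### Norm and incoherence bounds for the projections; the sampling operator as a sum. -/

section Operators

open ContinuousLinearMap InnerProductSpace

/-- Write (P − Q)x = P(1 − Q)x − (1 − P)Qx. The two pieces are orthogonal, and Pythagoras bounds
them by ‖(1 − Q)x‖² + ‖Qx‖² = ‖x‖². -/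
theorem norm_sub_le_one_of_isStarProjection {E : Type*} [NormedAddCommGroup E]
    [InnerProductSpace ℝ E] [CompleteSpace E] {P Q : E →L[ℝ] E} (hP : IsStarProjection P)
    (hQ : IsStarProjection Q) : ‖P - Q‖ ≤ 1 := by
  have horth : ∀ {R : E →L[ℝ] E}, IsStarProjection R → ∀ u v, inner ℝ (R u) (v - R v) = 0 := by
    intro R hR u v
    have h1 : R (R v) = R v := congrArg (fun T : E →L[ℝ] E => T v) hR.isIdempotentElem
    have h2 := hR.isSelfAdjoint.isSymmetric u (v - R v)
    simp only [coe_coe, map_sub, h1, sub_self, inner_zero_right] at h2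
    exact h2
  refine opNorm_le_bound _ zero_le_one fun x => ?_
  rw [one_mul]
  refine le_of_sq_le_sq ?_ (norm_nonneg x)
  have e : (P - Q) x = P (x - Q x) - (Q x - P (Q x)) := by
    rw [sub_apply, map_sub]
    abel
  have h1 : ‖P (x - Q x)‖ ≤ ‖x - Q x‖ :=
    (P.le_of_opNorm_le hP.norm_le _).trans (one_mul _).le
  have h2 : ‖Q x - P (Q x)‖ ≤ ‖Q x‖ :=
    ((1 - P).le_of_opNorm_le hP.one_sub.norm_le (Q x)).trans (one_mul _).le
  have h3 : ‖x‖ ^ 2 = ‖Q x‖ ^ 2 + ‖x - Q x‖ ^ 2 := by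
    have h := norm_add_sq_real (Q x) (x - Q x)
    rw [horth hQ, add_sub_cancel] at h
    linarith
  rw [e, norm_sub_sq_real, horth hP, h3]
  have h1' := pow_le_pow_left₀ (norm_nonneg _) h1 2
  have h2' := pow_le_pow_left₀ (norm_nonneg _) h2 2
  linarith

/-- The `j`-th column of a matrix. -/
noncomputable def frobCol {n : ℕ} (Z : FrobMat n) (j : Fin n) : EuclideanSpace ℝ (Fin n) :=
  WithLp.toLp 2 fun i => Z (i, j)

theorem inner_eq_sum_frobCol {n : ℕ} (Z W : FrobMat n) :
    inner ℝ Z W = ∑ j, inner ℝ (frobCol Z j) (frobCol W j) := by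
  simp only [PiLp.inner_apply, frobCol]
  rw [Fintype.sum_prod_type, Finset.sum_comm]

theorem norm_sq_eq_sum_frobCol {n : ℕ} (Z : FrobMat n) : ‖Z‖ ^ 2 = ∑ j, ‖frobCol Z j‖ ^ 2 := by
  simp only [← real_inner_self_eq_norm_sq]
  exact inner_eq_sum_frobCol Z Z

theorem frobCol_colProjOp {n k : ℕ} (U : Matrix (Fin n) (Fin k) ℝ) (Z : FrobMat n) (j : Fin n) :
    frobCol (colProjOp U Z) j = vecProj U (frobCol Z j) := rfl

theorem frobCol_sub {n : ℕ} (Z W : FrobMat n) (j : Fin n) :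
    frobCol (Z - W) j = frobCol Z j - frobCol W j := rfl

theorem frobMat_ext {n : ℕ} {Z W : FrobMat n} (h : ∀ j, frobCol Z j = frobCol W j) : Z = W := by
  ext ⟨i, j⟩
  exact congrArg (fun x : EuclideanSpace ℝ (Fin n) => x i) (h j)

theorem frobCol_single {n : ℕ} (p : Fin n × Fin n) (j : Fin n) :
    frobCol (EuclideanSpace.single p 1) j =
      if j = p.2 then EuclideanSpace.single p.1 1 else 0 := by
  ext i
  simp only [frobCol, PiLp.single_apply, Prod.ext_iff]
  by_cases h1 : i = p.1 <;> by_cases h2 : j = p.2 <;> simp [h1, h2]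

theorem isStarProjection_colProjOp {n k : ℕ} (U : Matrix (Fin n) (Fin k) ℝ) :
    IsStarProjection (colProjOp U) := by
  constructor
  · ext1 Z
    refine frobMat_ext fun j => ?_
    change frobCol (colProjOp U (colProjOp U Z)) j = _
    rw [frobCol_colProjOp, frobCol_colProjOp]
    exact congrArg (fun T : EuclideanSpace ℝ (Fin n) →L[ℝ] EuclideanSpace ℝ (Fin n) =>
      T (frobCol Z j)) (colSpace U).isIdempotentElem_starProjection
  · refine isSelfAdjoint_iff_isSymmetric.2 fun Z W => ?_
    simp only [coe_coe, inner_eq_sum_frobCol, frobCol_colProjOp]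
    exact Finset.sum_congr rfl fun j _ => (colSpace U).inner_starProjection_left_eq_right _ _

theorem norm_colProjOp_sub_single {n k l : ℕ} (U : Matrix (Fin n) (Fin k) ℝ)
    (U' : Matrix (Fin n) (Fin l) ℝ) (p : Fin n × Fin n) :
    ‖(colProjOp U - colProjOp U') (EuclideanSpace.single p 1)‖ =
      ‖vecProj U (EuclideanSpace.single p.1 1) - vecProj U' (EuclideanSpace.single p.1 1)‖ := by
  rw [← sq_eq_sq₀ (norm_nonneg _) (norm_nonneg _), norm_sq_eq_sum_frobCol,
    Finset.sum_eq_single p.2]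
  · rw [sub_apply, frobCol_sub, frobCol_colProjOp, frobCol_colProjOp, frobCol_single, if_pos rfl]
  · intro j _ hj
    rw [sub_apply, frobCol_sub, frobCol_colProjOp, frobCol_colProjOp, frobCol_single, if_neg hj]
    simp
  · simp

theorem norm_sq_starProjection_sub {E : Type*} [NormedAddCommGroup E] [InnerProductSpace ℝ E]
    (K : Submodule ℝ E) [K.HasOrthogonalProjection] (x : E) :
    ‖x - K.starProjection x‖ ^ 2 = ‖x‖ ^ 2 - ‖K.starProjection x‖ ^ 2 := by
  have h := K.starProjection_inner_eq_zero x _ (K.starProjection_apply_mem x)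
  have h' : ‖x‖ ^ 2 = ‖(x - K.starProjection x) + K.starProjection x‖ ^ 2 := by
    rw [sub_add_cancel]
  rw [norm_add_sq_real, h] at h'
  linarith

theorem sub_vecProj_single_apply_self {n k : ℕ} (U : Matrix (Fin n) (Fin k) ℝ) (i : Fin n) :
    (EuclideanSpace.single i 1 - vecProj U (EuclideanSpace.single i 1) :
      EuclideanSpace ℝ (Fin n)) i =
      1 - ‖vecProj U (EuclideanSpace.single i 1)‖ ^ 2 := by
  have h := (colSpace U).starProjection_inner_eq_zero (EuclideanSpace.single i 1) _
    ((colSpace U).starProjection_apply_mem (EuclideanSpace.single i 1))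
  have h1 := norm_sq_starProjection_sub (colSpace U) (EuclideanSpace.single i 1)
  rw [← real_inner_self_eq_norm_sq, inner_sub_right, h, sub_zero, EuclideanSpace.inner_single_right]
    at h1
  simpa [vecProj] using h1

theorem sum_sub_vecProj_mul_eq_zero {n k : ℕ} (U : Matrix (Fin n) (Fin k) ℝ)
    (x : EuclideanSpace ℝ (Fin n)) (l : Fin k) : ∑ i, (x - vecProj U x) i * U i l = 0 := by
  have h := (colSpace U).starProjection_inner_eq_zero x
    (Matrix.toEuclideanLin U (EuclideanSpace.single l 1)) ⟨_, rfl⟩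
  rw [PiLp.inner_apply] at h
  rw [← h]
  refine Finset.sum_congr rfl fun i _ => ?_
  simp [Matrix.toLpLin_apply, vecProj, mul_comm]

/-- The rank-one matrix f = (1 − P_U)e_i ((1 − P_V)e_j)ᵀ is orthogonal to the tangent space, so
projecting e = e_i e_jᵀ is the same as projecting e − f. With a = ‖P_U e_i‖² and b = ‖P_V e_j‖², ‖e
− f‖² = 1 − (1 − a)(1 − b) ≤ a + b. -/
theorem norm_sq_tangentProj_single_le {n r : ℕ} (U V : Matrix (Fin n) (Fin r) ℝ)
    (p : Fin n × Fin n) :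
    ‖tangentProj U V (EuclideanSpace.single p 1)‖ ^ 2 ≤
      ‖vecProj U (EuclideanSpace.single p.1 1)‖ ^ 2 +
        ‖vecProj V (EuclideanSpace.single p.2 1)‖ ^ 2 := by
  set x := EuclideanSpace.single p.1 1 - vecProj U (EuclideanSpace.single p.1 1) with hx
  set y := EuclideanSpace.single p.2 1 - vecProj V (EuclideanSpace.single p.2 1) with hy
  set e : FrobMat n := EuclideanSpace.single p 1 with he
  set f : FrobMat n := WithLp.toLp 2 fun q => x q.1 * y q.2 with hf
  have hfT : f ∈ (tangentSpace U V)ᗮ := by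
    rw [Submodule.mem_orthogonal']
    rintro W ⟨Z₁, Z₂, hW⟩
    have hW' : ∀ i j, W (i, j) = ∑ l, U i l * Z₁ j l + ∑ l, Z₂ i l * V j l := fun i j =>
      congrFun (congrFun hW i) j
    rw [PiLp.inner_apply, Fintype.sum_prod_type]
    have h1 : ∑ i, ∑ j, (x i * y j) * ∑ l, U i l * Z₁ j l = 0 := by
      rw [Finset.sum_comm]
      refine Finset.sum_eq_zero fun j _ => ?_
      simp only [Finset.mul_sum]
      rw [Finset.sum_comm]
      refine Finset.sum_eq_zero fun l _ => ?_
      calc _ = (∑ i, x i * U i l) * (y j * Z₁ j l) := by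
            rw [Finset.sum_mul]
            exact Finset.sum_congr rfl fun i _ => by ring
        _ = 0 := by rw [sum_sub_vecProj_mul_eq_zero, zero_mul]
    have h2 : ∑ i, ∑ j, (x i * y j) * ∑ l, Z₂ i l * V j l = 0 := by
      refine Finset.sum_eq_zero fun i _ => ?_
      simp only [Finset.mul_sum]
      rw [Finset.sum_comm]
      refine Finset.sum_eq_zero fun l _ => ?_
      calc _ = (∑ j, y j * V j l) * (x i * Z₂ i l) := by
            rw [Finset.sum_mul]
            exact Finset.sum_congr rfl fun i _ => by ring
        _ = 0 := by rw [sum_sub_vecProj_mul_eq_zero, zero_mul]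
    rw [← add_zero (0 : ℝ)]
    nth_rewrite 1 [← h1]
    rw [← h2, ← Finset.sum_add_distrib]
    refine Finset.sum_congr rfl fun i _ => ?_
    rw [← Finset.sum_add_distrib]
    refine Finset.sum_congr rfl fun j _ => ?_
    rw [hW', ← mul_add, real_inner_comm]
    rfl
  have hPf : tangentProj U V f = 0 := (Submodule.starProjection_apply_eq_zero_iff _).2 hfT
  have hle : ‖tangentProj U V e‖ ≤ ‖e - f‖ := by
    rw [← sub_zero (tangentProj U V e), ← hPf, ← map_sub]
    exact Submodule.norm_starProjection_apply_le _ _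
  have hxi : x p.1 = 1 - ‖vecProj U (EuclideanSpace.single p.1 1)‖ ^ 2 :=
    sub_vecProj_single_apply_self U p.1
  have hyi : y p.2 = 1 - ‖vecProj V (EuclideanSpace.single p.2 1)‖ ^ 2 :=
    sub_vecProj_single_apply_self V p.2
  have hxn : ‖x‖ ^ 2 = x p.1 := by
    rw [hxi, hx]
    refine (norm_sq_starProjection_sub (colSpace U) _).trans ?_
    simp [vecProj]
  have hyn : ‖y‖ ^ 2 = y p.2 := by
    rw [hyi, hy]
    refine (norm_sq_starProjection_sub (colSpace V) _).trans ?_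
    simp [vecProj]
  have hfn : ‖f‖ ^ 2 = x p.1 * y p.2 := by
    rw [← hxn, ← hyn, EuclideanSpace.real_norm_sq_eq, EuclideanSpace.real_norm_sq_eq,
      EuclideanSpace.real_norm_sq_eq, Fintype.sum_prod_type, Finset.sum_mul_sum]
    simp only [hf, mul_pow]
  have hef : inner ℝ e f = x p.1 * y p.2 := by
    rw [he, EuclideanSpace.inner_single_left]
    simp [hf]
  have hen : ‖e‖ = 1 := by simp [he]
  calc _ ≤ ‖e - f‖ ^ 2 := by gcongr
    _ = 1 - x p.1 * y p.2 := by rw [norm_sub_sq_real, hef, hfn, hen]; ring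
    _ ≤ _ := by
      rw [hxi, hyi]
      nlinarith [mul_nonneg (sq_nonneg ‖vecProj U (EuclideanSpace.single p.1 1)‖)
        (sq_nonneg ‖vecProj V (EuclideanSpace.single p.2 1)‖)]

theorem sampling_apply {n m : ℕ} (w : Fin m → Fin n × Fin n) (Z : FrobMat n) :
    sampling w Z = ∑ k, EuclideanSpace.single (w k) (Z (w k)) := by
  ext p
  change Z p * (∑ k, Matrix.single (w k).1 (w k).2 (1 : ℝ)) p.1 p.2 = _
  rw [Matrix.sum_apply, Finset.mul_sum, WithLp.ofLp_sum, Finset.sum_apply]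
  refine Finset.sum_congr rfl fun k _ => ?_
  simp only [Matrix.single_apply, PiLp.single_apply]
  by_cases h : p = w k
  · simp [h]
  · rw [if_neg h, if_neg fun h' => h (Prod.ext h'.1.symm h'.2.symm), mul_zero]

theorem comp_sampling_comp {n m : ℕ} (hm : 0 < m) (w : Fin m → Fin n × Fin n)
    (A : FrobMat n →L[ℝ] FrobMat n) {B : FrobMat n →L[ℝ] FrobMat n} (hB : IsSelfAdjoint B) :
    ((n : ℝ) ^ 2 / m) • (A ∘L sampling w ∘L B) - A ∘L B =
      (m : ℝ)⁻¹ • ∑ k, centredSample A B (w k) := by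
  have hm' : (m : ℝ) ≠ 0 := by exact_mod_cast hm.ne'
  have h : A ∘L sampling w ∘L B = ∑ k, rankOne ℝ (A (EuclideanSpace.single (w k) 1))
      (B (EuclideanSpace.single (w k) 1)) := by
    ext1 x
    rw [sum_apply]
    simp only [rankOne_apply_single hB, comp_apply, sampling_apply, map_sum]
  simp only [centredSample]
  rw [h, Finset.sum_sub_distrib, ← Finset.smul_sum, Finset.sum_const, Finset.card_univ,
    Fintype.card_fin, Fintype.card_prod, Fintype.card_fin, smul_sub, smul_smul,
    ← Nat.cast_smul_eq_nsmul ℝ, smul_smul, inv_mul_cancel₀ hm', one_smul]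
  congr 2
  push_cast
  ring

end Operators

/-! ### From counting outcomes to probabilities. -/

section Probability

-- By independence and uniformity every outcome has probability N^(−m), where N = n².
open Classical in
theorem IsUniformSample.measureReal_mem_eq {S : Type*} [MeasurableSpace S] {P : Measure S}
    [IsProbabilityMeasure P] {n m : ℕ} {ω : Fin m → S → Fin n × Fin n}
    (hω : IsUniformSample P ω) (G : (Fin m → Fin n × Fin n) → Prop) :
    P.real {s | G fun k => ω k s} =
      (Finset.univ.filter G).card * ((Fintype.card (Fin n × Fin n) : ℝ)⁻¹) ^ m := by
  have hone : ∀ k p, P.real (ω k ⁻¹' {p}) = (Fintype.card (Fin n × Fin n) : ℝ)⁻¹ := fun k p => by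
    rw [← map_measureReal_apply (hω.measurable k) (measurableSet_singleton p), hω.uniform k,
      Measure.real, uniformOn_univ]
    simp
  have hpt : ∀ w : Fin m → Fin n × Fin n, P.real {s | (fun k => ω k s) = w} =
      ((Fintype.card (Fin n × Fin n) : ℝ)⁻¹) ^ m := fun w => by
    have h := hω.indep.measure_inter_preimage_eq_mul Finset.univ (sets := fun k => {w k})
      fun k _ => measurableSet_singleton _
    have e : {s | (fun k => ω k s) = w} = ⋂ k ∈ Finset.univ, ω k ⁻¹' {w k} := by
      ext s
      simp [funext_iff]
    rw [e, Measure.real, h, ENNReal.toReal_prod]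
    calc _ = ∏ k : Fin m, (Fintype.card (Fin n × Fin n) : ℝ)⁻¹ :=
          Finset.prod_congr rfl fun k _ => hone k (w k)
      _ = _ := by simp
  have e : {s | G fun k => ω k s} =
      ⋃ w ∈ Finset.univ.filter G, {s | (fun k => ω k s) = w} := by
    ext s
    simp
  have hmeas : Measurable fun s => fun k => ω k s := measurable_pi_lambda _ hω.measurable
  rw [e, measureReal_biUnion_finset]
  · rw [Finset.sum_congr rfl fun w _ => hpt w, Finset.sum_const, nsmul_eq_mul]
  · intro w _ w' _ hne
    refine Set.disjoint_left.2 fun s hs hs' => hne (hs.symm.trans hs')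
  · exact fun w _ => hmeas (measurableSet_singleton w)

theorem IsUniformSample.one_sub_le_measureReal {S : Type*} [MeasurableSpace S] {P : Measure S}
    [IsProbabilityMeasure P] {n m : ℕ} {ω : Fin m → S → Fin n × Fin n}
    (hω : IsUniformSample P ω) (hn : 0 < n) (F : (Fin m → Fin n × Fin n) → ℝ) {τ δ : ℝ}
    (h : open scoped Classical in ((Finset.univ.filter fun w => τ < F w).card : ℝ) ≤
      δ * (Fintype.card (Fin n × Fin n) : ℝ) ^ m) :
    1 - δ ≤ P.real {s | F (fun k => ω k s) ≤ τ} := by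
  classical
  have hN : (0 : ℝ) < Fintype.card (Fin n × Fin n) := by
    simpa using hn.ne'
  have hmeas : Measurable fun s => fun k => ω k s := measurable_pi_lambda _ hω.measurable
  have hset : MeasurableSet {s | τ < F fun k => ω k s} :=
    hmeas (Set.toFinite {w | τ < F w}).measurableSet
  have hc := probReal_compl_eq_one_sub (μ := P) hset
  have e : {s | τ < F fun k => ω k s}ᶜ = {s | F (fun k => ω k s) ≤ τ} := by
    ext s
    simp
  rw [e, hω.measureReal_mem_eq fun w => τ < F w] at hc
  rw [hc]
  gcongr
  rw [inv_pow, ← div_eq_mul_inv, div_le_iff₀ (by positivity)]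
  convert h

end Probability

end MatrixCompletion

/-! ### Degenerate cases and choice of constants. -/

open MatrixCompletion

theorem mainTheorem6 {n r m : ℕ} {μ β : ℝ} (hμ : 0 < μ) (hβ : 1 < β)
    (X Xl : Matrix (Fin n) (Fin n) ℝ)
    (U V Ul Vl : Matrix (Fin n) (Fin r) ℝ) (σ σl : Fin r → ℝ)
    (hX : MatrixCompletion.IsReducedSVD X U σ V)
    (hXl : MatrixCompletion.IsReducedSVD Xl Ul σl Vl)
    (hincl : MatrixCompletion.IsIncoherent μ Ul Vl)
    (hinc : MatrixCompletion.IsIncoherent μ U V)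
    {S : Type*} [MeasurableSpace S] (P : MeasureTheory.Measure S)
    [MeasureTheory.IsProbabilityMeasure P]
    (ω : Fin m → S → Fin n × Fin n) (hω : MatrixCompletion.IsUniformSample P ω)
    (hm : 15 * β * μ * n * r * Real.log n ≤ (m : ℝ)) :
    1 - 2 * (n : ℝ) ^ (2 - 2 * β) ≤
      P.real {s | ‖((n : ℝ) ^ 2 / (m : ℝ)) •
            (MatrixCompletion.tangentProj Ul Vl ∘L MatrixCompletion.sampling (fun k => ω k s) ∘L
              (MatrixCompletion.colProjOp U - MatrixCompletion.colProjOp Ul)) -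
          MatrixCompletion.tangentProj Ul Vl ∘L
            (MatrixCompletion.colProjOp U - MatrixCompletion.colProjOp Ul)‖
        ≤ √(48 * β * μ * n * r * Real.log n / m)} := by
  set A := tangentProj Ul Vl with hA
  set B := colProjOp U - colProjOp Ul with hB
  have hB0 : B = 0 → 1 - 2 * (n : ℝ) ^ (2 - 2 * β) ≤ P.real {s | ‖((n : ℝ) ^ 2 / (m : ℝ)) •
      (A ∘L sampling (fun k => ω k s) ∘L B) - A ∘L B‖
        ≤ √(48 * β * μ * n * r * Real.log n / m)} := by
    intro h
    have : 0 ≤ (n : ℝ) ^ (2 - 2 * β) := Real.rpow_nonneg (Nat.cast_nonneg n) _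
    have e : ∀ s, ((n : ℝ) ^ 2 / (m : ℝ)) • (A ∘L sampling (fun k => ω k s) ∘L B) - A ∘L B = 0 := by
      intro s
      rw [h]
      ext1 x
      simp
    simp only [e]
    rw [norm_zero]
    simp only [Real.sqrt_nonneg, Set.ofPred_true, probReal_univ]
    linarith
  rcases Nat.eq_zero_or_pos n with rfl | hn0
  · exact hB0 (ContinuousLinearMap.ext fun x => Subsingleton.elim _ _)
  rcases Nat.eq_zero_or_pos r with rfl | hr0
  · refine hB0 ?_
    rw [hB, Subsingleton.elim U Ul, sub_self]
  rcases Nat.lt_or_ge 1 n with hn1 | hn1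
  swap
  -- Here log n = 0 and the tail bound is void, but the claimed probability is at least 1 − 2 < 0.
  · obtain rfl : n = 1 := le_antisymm hn1 hn0
    have := measureReal_nonneg (μ := P) (s := {s | ‖(((1 : ℕ) : ℝ) ^ 2 / (m : ℝ)) •
      (A ∘L sampling (fun k => ω k s) ∘L B) - A ∘L B‖
        ≤ √(48 * β * μ * (1 : ℕ) * r * Real.log (1 : ℕ) / m)})
    refine le_trans ?_ this
    norm_num
  have hn : (0 : ℝ) < n := by exact_mod_cast hn0
  have hr : (0 : ℝ) < r := by exact_mod_cast hr0
  have hlog : 0 < Real.log n := Real.log_pos (by exact_mod_cast hn1)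
  have hβ0 : 0 < β := zero_lt_one.trans hβ
  have hm' : (0 : ℝ) < m := lt_of_lt_of_le (by positivity) hm
  have hm0 : 0 < m := by exact_mod_cast hm'
  have : Nonempty (Fin n × Fin n) := ⟨(⟨0, hn0⟩, ⟨0, hn0⟩)⟩
  have hAs : IsSelfAdjoint A := isSelfAdjoint_starProjection _
  have hBs : IsSelfAdjoint B :=
    IsSelfAdjoint.sub (R := FrobMat n →L[ℝ] FrobMat n)
      (isStarProjection_colProjOp U).isSelfAdjoint (isStarProjection_colProjOp Ul).isSelfAdjoint
  set q : ℝ := μ * r / n with hq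
  have hq0 : 0 ≤ q := by positivity
  have hsq : ∀ {x : ℝ}, 0 ≤ x → x ≤ √q → x ^ 2 ≤ q := fun hx h =>
    (Real.le_sqrt hx hq0).1 h
  have hAp : ∀ p, ‖A (EuclideanSpace.single p 1)‖ ^ 2 ≤ 2 * q := fun p => by
    have h1 := norm_sq_tangentProj_single_le Ul Vl p
    have h2 := hsq (norm_nonneg _) (hincl.1 p.1)
    have h3 := hsq (norm_nonneg _) (hincl.2 p.2)
    linarith
  have hBp : ∀ p, ‖B (EuclideanSpace.single p 1)‖ ^ 2 ≤ 4 * q := fun p => by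
    rw [hB, norm_colProjOp_sub_single]
    have h1 := (norm_sub_le _ _).trans (add_le_add (hinc.1 p.1) (hincl.1 p.1))
    calc _ ≤ (√q + √q) ^ 2 := by gcongr
      _ = 4 * √q ^ 2 := by ring
      _ = 4 * q := by rw [Real.sq_sqrt hq0]
  set τ : ℝ := √(48 * β * μ * n * r * Real.log n / m) with hτ
  have hτ0 : 0 < τ := Real.sqrt_pos.2 (by positivity)
  have hτsq : τ ^ 2 = 48 * β * μ * n * r * Real.log n / m := Real.sq_sqrt (by positivity)
  -- The sampling hypothesis gives τ² ≤ 48/15 < 4.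
  have hτ2 : τ ≤ 2 := by
    refine Real.sqrt_le_iff.2 ⟨by norm_num, ?_⟩
    rw [div_le_iff₀ hm']
    linarith
  have hcard : (Fintype.card (Fin n × Fin n) : ℝ) = (n : ℝ) ^ 2 := by
    simp [pow_two]
  have hNq : (n : ℝ) ^ 2 * q = μ * r * n := by
    rw [hq]
    field_simp
  have hK : 0 < μ * r * n := by positivity
  -- With a = 2q, b = 4q and n²q = μrn, the constant 6 dominates 2 and 4, and 6² = 36 dominates
  -- 4·2·4 = 32.
  have h := card_lt_norm_sum_centredSample_le (L := 6 * (μ * r * n)) hAs hBs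
    (Submodule.starProjection_norm_le _)
    (norm_sub_le_one_of_isStarProjection (isStarProjection_colProjOp U)
      (isStarProjection_colProjOp Ul)) hAp hBp
    (by rw [hcard]; linarith) (by rw [hcard]; linarith)
    (by
      rw [hcard]
      calc _ = 32 * ((n : ℝ) ^ 2 * q) ^ 2 := by ring
        _ ≤ _ := by rw [hNq]; nlinarith [sq_nonneg (μ * r * n)]) (by positivity) hτ0 hτ2 hm0
  have hexp : 2 * (Fintype.card (Fin n × Fin n) : ℝ) *
      Real.exp (-(m * τ ^ 2 / (4 * (6 * (μ * r * n))))) = 2 * (n : ℝ) ^ (2 - 2 * β) := by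
    -- Here 48β/24 = 2β; the dimension n² of the matrix space supplies the other factor of n^(2−2β).
    have e : -(m * τ ^ 2 / (4 * (6 * (μ * r * n)))) = Real.log n * (-(2 * β)) := by
      rw [hτsq]
      field_simp
      norm_num
    rw [e, ← Real.rpow_def_of_pos hn, hcard, sub_eq_add_neg, Real.rpow_add hn, Real.rpow_two]
    ring
  rw [hexp] at h
  simp only [comp_sampling_comp hm0 _ A hBs]
  exact hω.one_sub_le_measureReal hn0
    (fun w => ‖(m : ℝ)⁻¹ • ∑ k, centredSample A B (w k)‖) (by convert h)
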